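/- Let $X_1,X_2,\dots$ be independent random variables with common absolutely continuous c.d.f. $F$ and density $f=F'$, and let $X_{(1,n)}\le\dots\le X_{(n,n)}$ be the order statistics of $X_1,\dots,X_n$. For $0<p<1$ put $F^{\leftarrow}(p)=\inf\{x\in\mathbb R: F(x)\ge p\}$ and $F_n^{\leftarrow}(p)=X_{([(n+1)p],\,n)}$, where $[a]$ is the integer part of $a$. The theoretical left and right $p$-fences are $$L(F,p)=F^{\leftarrow}(p)-\tfrac{1-p}{p}\bigl(F^{\leftarrow}(1-p)-F^{\leftarrow}(p)\bigr),\qquad R(F,p)=F^{\leftarrow}(1-p)+\tfrac{1-p}{p}\bigl(F^{\leftarrow}(1-p)-F^{\leftarrow}(p)\bigr),$$ and the empirical fences $L_n(F,p)$, $R_n(F,p)$ are defined by the same formulas with $F_n^{\leftarrow}$ in place of $F^{\leftarrow}$. Fix an integer $s\ge 1$ and let $n=n_k=(s+1)k-1$, $k=1,2,\dots$. Suppose that $F$ is differentiable at $F^{\leftarrow}\bigl(\frac1{s+1}\bigr)$ and at $F^{\leftarrow}\bigl(\frac s{s+1}\bigr)$, with derivatives $$c=f\Bigl(F^{\leftarrow}\bigl(\tfrac1{s+1}\bigr)\Bigr)\in(0,\infty),\qquad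 d=f\Bigl(F^{\leftarrow}\bigl(\tfrac s{s+1}\bigr)\Bigr)\in(0,\infty).$$ Then: 1. If $L_{n_k}\bigl(F,\frac1{s+1}\bigr)$ is integrable for at least one $k\ge1$, then it is integrable for all sufficiently large $k$ and $$\lim_{k\to\infty}E\,L_{n_k}\bigl(F,\tfrac1{s+1}\bigr)=L\bigl(F,\tfrac1{s+1}\bigr).$$ Likewise, if $R_{n_k}\bigl(F,\frac1{s+1}\bigr)$ is integrable for at least one $k\ge1$, then it is integrable for all sufficiently large $k$ and $\lim_{k\to\infty}E\,R_{n_k}\bigl(F,\frac1{s+1}\bigr)=R\bigl(F,\frac1{s+1}\bigr)$. 2. As $k\to\infty$, $$\sqrt{n_k}\,\Bigl(L_{n_k}\bigl(F,\tfrac1{s+1}\bigr)-L\bigl(F,\tfrac1{s+1}\bigr)\Bigr)\xrightarrow{d}N(0,V_{L,F,s}),\qquad \sqrt{n_k}\,\Bigl(R_{n_k}\bigl(F,\tfrac1{s+1}\bigr)-R\bigl(F,\tfrac1{s+1}\bigr)\Bigr)\xrightarrow{d}N(0,V_{R,F,s}),$$ where $$V_{L,F,s}=\frac{s}{(s+1)^2}\Bigl[\frac{(s+1)^2}{c^2}-\frac{2(s+1)}{cd}+\frac{s^2}{d^2}\Bigr],\qquad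 V_{R,F,s}=\frac{s}{(s+1)^2}\Bigl[\frac{s^2}{c^2}-\frac{2(s+1)}{cd}+\frac{(s+1)^2}{d^2}\Bigr].$$ -/

import Mathlib

open MeasureTheory ProbabilityTheory Filter Topology

noncomputable section

namespace Fences

/-- The theoretical quantile function `F^←(p) = inf {x : F(x) ≥ p}` of the c.d.f. `F` of the
probability law `μ`. -/
def quantile (μ : Measure ℝ) (p : ℝ) : ℝ :=
  sInf {x : ℝ | p ≤ cdf μ x}

/-- The `i`-th order statistic (`1 ≤ i ≤ n`, the `i`-th smallest value) of a sample
`x` of size `n`; the value outside this range of indices is `0`. -/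
def orderStat {n : ℕ} (x : Fin n → ℝ) (i : ℕ) : ℝ :=
  if h : 1 ≤ i ∧ i ≤ n then x (Tuple.sort x ⟨i - 1, by omega⟩) else 0

/-- The empirical quantile `F_n^←(p) = X_([(n+1)p], n)`, `[a]` being the integer part. -/
def empQuantile {n : ℕ} (x : Fin n → ℝ) (p : ℝ) : ℝ :=
  orderStat x ⌊((n : ℝ) + 1) * p⌋₊

/-- The theoretical left `p`-fence `L(F, p)`. -/
def leftFence (μ : Measure ℝ) (p : ℝ) : ℝ :=
  quantile μ p - (1 - p) / p * (quantile μ (1 - p) - quantile μ p)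

/-- The theoretical right `p`-fence `R(F, p)`. -/
def rightFence (μ : Measure ℝ) (p : ℝ) : ℝ :=
  quantile μ (1 - p) + (1 - p) / p * (quantile μ (1 - p) - quantile μ p)

/-- The empirical left `p`-fence `L_n(F, p)` of a sample. -/
def empLeftFence {n : ℕ} (x : Fin n → ℝ) (p : ℝ) : ℝ :=
  empQuantile x p - (1 - p) / p * (empQuantile x (1 - p) - empQuantile x p)

/-- The empirical right `p`-fence `R_n(F, p)` of a sample. -/
def empRightFence {n : ℕ} (x : Fin n → ℝ) (p : ℝ) : ℝ :=
  empQuantile x (1 - p) + (1 - p) / p * (empQuantile x (1 - p) - empQuantile x p)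

/-- The first `n` observations of a sequence of random variables. -/
def sample {Ω : Type*} (X : ℕ → Ω → ℝ) (n : ℕ) (ω : Ω) : Fin n → ℝ :=
  fun i ↦ X i ω

/-- The sample size `n = (s+1)k - 1` (used for `k ≥ 1`). -/
def size (s k : ℕ) : ℕ := (s + 1) * k - 1

/-- The variance `V_{L,F,s}`, in terms of `c = f(F^←(1/(s+1)))` and `d = f(F^←(s/(s+1)))`. -/
def varLeft (s : ℕ) (c d : ℝ) : ℝ :=
  s / (s + 1) ^ 2 * ((s + 1) ^ 2 / c ^ 2 - 2 * (s + 1) / (c * d) + s ^ 2 / d ^ 2)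

/-- The variance `V_{R,F,s}`. -/
def varRight (s : ℕ) (c d : ℝ) : ℝ :=
  s / (s + 1) ^ 2 * (s ^ 2 / c ^ 2 - 2 * (s + 1) / (c * d) + (s + 1) ^ 2 / d ^ 2)

/-- `Y k` converges in distribution, as `k → ∞`, to the normal law `N(0, V)`; in particular
`V` is nonnegative. -/
def TendstoNormal {Ω : Type*} [MeasurableSpace Ω] (P : Measure Ω) [IsProbabilityMeasure P]
    (Y : ℕ → Ω → ℝ) (V : ℝ) : Prop :=
  ∃ v : NNReal, (v : ℝ) = V ∧
    TendstoInDistribution Y atTop (id : ℝ → ℝ) (fun _ ↦ P) (gaussianReal 0 v)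

end Fences

end

/-!
With sample size `n = (s+1)k - 1` the two empirical fences are, exactly, linear combinations
`a X_(k) + b X_(sk)` of two order statistics, with `a + b = 1` and `a, b ≠ 0`
(`Fences.empLeftFence_size`, `Fences.empRightFence_size`). Everything is proved for such
combinations in `Fences.tendsto_mean_and_tendstoNormal_lin`.

*Asymptotic normality.* The event `X_(i) ≤ t` says that at least `i` observations are at most `t`,
so that it is a statement about the empirical process `G_n(t) = √n (F_n(t) - F(t))`. If `F` has
derivative `c > 0` at `q`, then along `t = q + y/√n` the increments of `G_n` around `q` vanish by
Chebyshev's inequality, and the event becomes, up to small probability, `-G_n(q)/c ≤ y`. By Ghosh's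
lemma (`Fences.tendstoInMeasure_sub_of_separation`) this gives the weak Bahadur representation
`√n (X_(i) - q) = -G_n(q)/c + o_P(1)` (`Fences.tendstoInMeasure_orderStat_sub_empProcess`). A
combination of two order statistics is therefore asymptotically a normalised sum of i.i.d. bounded
variables, to which the central limit theorem and Slutsky's theorem apply.

*Means.* If the statistic is integrable for one `k = l`, consider the event that `l` observations
lie beyond `t` on one side and all others in a bounded interval. One of the two order statistics is
then of size `t` and the other is bounded (for `s = 1` they coincide), so Markov's inequality gives
`P(|X| > t)^l = O(1/t)` (`Fences.exists_tail_bound_of_integrable`). Conversely, an order statistic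
of rank `k` or `sk` exceeds `t` in absolute value only if `k` observations do, which has probability
at most `(2^{s+1} P(|X| > t))^k`; this is `O(t⁻²)` uniformly in `k ≥ 2l`
(`Fences.exists_uniform_tail_bound`). Together with consistency and dominated convergence in the
layer cake formula, the order statistics converge in `L¹`.
-/

namespace Fences

/-! ### Order statistics and counting -/

lemma exists_orderStat_eq {n : ℕ} (x : Fin n → ℝ) {i : ℕ} (hi : 1 ≤ i) (hin : i ≤ n) :
    ∃ j, orderStat x i = x j :=
  ⟨_, dif_pos ⟨hi, hin⟩⟩

/-- The counting characterisation of order statistics: the `i`-th smallest value is at most `t`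
exactly when at least `i` of the values are. -/
lemma orderStat_le_iff {n : ℕ} (x : Fin n → ℝ) {i : ℕ} (hi : 1 ≤ i) (hin : i ≤ n) (t : ℝ) :
    orderStat x i ≤ t ↔ i ≤ (Finset.univ.filter fun j ↦ x j ≤ t).card := by
  have hcard : (Finset.univ.filter fun j ↦ x (Tuple.sort x j) ≤ t).card =
      (Finset.univ.filter fun j ↦ x j ≤ t).card :=
    Finset.card_equiv (Tuple.sort x) (by simp)
  rw [orderStat, dif_pos ⟨hi, hin⟩, ← hcard]
  have h := Tuple.lt_card_le_iff_apply_le_of_monotone (a := t)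
    (j := (⟨i - 1, by omega⟩ : Fin n)) (Tuple.monotone_sort x)
  simp only [Function.comp_apply] at h
  rw [← h]
  omega

lemma measurable_orderStat {n : ℕ} (i : ℕ) :
    Measurable fun x : Fin n → ℝ ↦ orderStat x i := by
  by_cases h : 1 ≤ i ∧ i ≤ n
  · refine measurable_of_Iic fun t ↦ ?_
    have : (fun x : Fin n → ℝ ↦ orderStat x i) ⁻¹' Set.Iic t =
        {x | (i : ℝ) ≤ ∑ j, (Set.Iic t).indicator (fun _ ↦ (1 : ℝ)) (x j)} := by
      ext x
      simp [orderStat_le_iff x h.1 h.2, Set.indicator_apply]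
    rw [this]
    refine measurableSet_le measurable_const (Finset.measurable_sum _ fun j _ ↦ ?_)
    exact (measurable_const.indicator measurableSet_Iic).comp (measurable_pi_apply j)
  · simp only [orderStat, dif_neg h]
    exact measurable_const

/-- If an order statistic exceeds `t` in absolute value, then so do at least as many
observations as there are ranks on the shorter side of it. -/
lemma le_card_of_lt_abs_orderStat {n : ℕ} (x : Fin n → ℝ) {i m : ℕ} (hi : 1 ≤ i) (hin : i ≤ n)
    (hmi : m ≤ i) (hmn : m + i ≤ n + 1) {t : ℝ} (h : t < |orderStat x i|) :
    m ≤ (Finset.univ.filter fun j ↦ t < |x j|).card := by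
  rcases lt_abs.1 h with h | h
  · have h1 : ¬ i ≤ (Finset.univ.filter fun j ↦ x j ≤ t).card := by
      rw [← orderStat_le_iff x hi hin]
      exact not_le.2 h
    have h2 := Finset.card_filter_add_card_filter_not (s := Finset.univ) (fun j ↦ x j ≤ t)
    have h3 : (Finset.univ.filter fun j ↦ ¬ x j ≤ t).card ≤
        (Finset.univ.filter fun j ↦ t < |x j|).card :=
      Finset.card_le_card <| Finset.monotone_filter_right _ fun j _ hj ↦
        lt_abs.2 (Or.inl (not_le.1 hj))
    simp only [Finset.card_univ, Fintype.card_fin] at h2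
    omega
  · have h1 := (orderStat_le_iff x hi hin _).1 le_rfl
    refine hmi.trans (h1.trans <| Finset.card_le_card <|
      Finset.monotone_filter_right _ fun j _ hj ↦ lt_abs.2 (Or.inr ?_))
    linarith

lemma aemeasurable_orderStat_sample {Ω : Type*} [MeasurableSpace Ω] {P : Measure Ω}
    {X : ℕ → Ω → ℝ} (hX : ∀ i, AEMeasurable (X i) P) (n i : ℕ) :
    AEMeasurable (fun ω ↦ orderStat (sample X n ω) i) P :=
  (measurable_orderStat i).comp_aemeasurable (aemeasurable_pi_lambda _ fun j ↦ hX j)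

/-! ### The empirical process -/

/-- The empirical process `n^{-1/2} ∑_{j<n} (g(X_j) - ∫ g dμ)` of a sample with law `μ`, indexed
by the test function `g`. -/
noncomputable def empDev {Ω : Type*} (μ : Measure ℝ) (X : ℕ → Ω → ℝ) (n : ℕ) (g : ℝ → ℝ)
    (ω : Ω) : ℝ :=
  (√n)⁻¹ * ∑ j ∈ Finset.range n, (g (X j ω) - ∫ x, g x ∂μ)

section

variable {Ω : Type*} [MeasurableSpace Ω] {P : Measure Ω} [IsProbabilityMeasure P]
  {μ : Measure ℝ} {X : ℕ → Ω → ℝ}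

/-- Chebyshev's inequality for the empirical process, uniform in the sample size. -/
lemma measure_le_abs_empDev (hlaw : ∀ i, HasLaw (X i) μ P) (hindep : iIndepFun X P)
    {g : ℝ → ℝ} (hgm : Measurable g) (hg : MemLp g 2 μ) (n : ℕ) {ε : ℝ} (hε : 0 < ε) :
    P {ω | ε ≤ |empDev μ X n g ω|} ≤ ENNReal.ofReal (Var[g; μ] / ε ^ 2) := by
  have hLp : ∀ i, MemLp (g ∘ X i) 2 P := fun i ↦ by
    refine MemLp.comp_of_map ?_ (hlaw i).aemeasurable
    rwa [(hlaw i).map_eq]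
  have hint : ∀ i, ∫ ω, (g ∘ X i) ω ∂P = ∫ x, g x ∂μ := fun i ↦
    (hlaw i).integral_comp hgm.aestronglyMeasurable
  have hvar : ∀ i, Var[g ∘ X i; P] = Var[g; μ] := fun i ↦ by
    rw [← (hlaw i).map_eq, variance_map hgm.aemeasurable (hlaw i).aemeasurable]
  have hS : MemLp (∑ i ∈ Finset.range n, g ∘ X i) 2 P := memLp_finsetSum' _ fun i _ ↦ hLp i
  have hT : MemLp (fun ω ↦ (√n)⁻¹ * (∑ i ∈ Finset.range n, g ∘ X i) ω) 2 P := hS.const_mul _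
  have hET : ∫ ω, (√n)⁻¹ * (∑ i ∈ Finset.range n, g ∘ X i) ω ∂P = (√n)⁻¹ * (n * ∫ x, g x ∂μ) := by
    rw [integral_const_mul]
    simp only [Finset.sum_apply]
    rw [integral_finsetSum _ fun i _ ↦ (hLp i).integrable one_le_two,
      Finset.sum_congr rfl fun i _ ↦ hint i]
    simp
  have hvT : Var[fun ω ↦ (√n)⁻¹ * (∑ i ∈ Finset.range n, g ∘ X i) ω; P] ≤ Var[g; μ] := by
    rw [variance_const_mul, IndepFun.variance_sum (fun i _ ↦ hLp i)
      fun i _ j _ hij ↦ (hindep.indepFun hij).comp hgm hgm]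
    simp only [hvar, Finset.sum_const, Finset.card_range, nsmul_eq_mul]
    rcases Nat.eq_zero_or_pos n with rfl | hn
    · simp
    · have : (0 : ℝ) < n := by exact_mod_cast hn
      rw [inv_pow, Real.sq_sqrt this.le, inv_mul_cancel_left₀ this.ne']
  have h := meas_ge_le_variance_div_sq hT hε
  rw [hET] at h
  have heq : ∀ ω, empDev μ X n g ω =
      (√n)⁻¹ * (∑ i ∈ Finset.range n, g ∘ X i) ω - (√n)⁻¹ * (n * ∫ x, g x ∂μ) := fun ω ↦ by
    simp [empDev, Finset.sum_sub_distrib, mul_sub]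
  simp only [heq]
  exact h.trans (ENNReal.ofReal_le_ofReal (by gcongr))

/-- The central limit theorem for the empirical process at a fixed test function. -/
lemma tendstoInDistribution_empDev (hlaw : ∀ i, HasLaw (X i) μ P) (hindep : iIndepFun X P)
    {g : ℝ → ℝ} (hgm : Measurable g) (hg : MemLp g 2 μ) :
    TendstoInDistribution (fun n ↦ empDev μ X n g) atTop (id : ℝ → ℝ) (fun _ ↦ P)
      (gaussianReal 0 Var[g; μ].toNNReal) := by
  have hint : ∫ ω, (g ∘ X 0) ω ∂P = ∫ x, g x ∂μ :=
    (hlaw 0).integral_comp hgm.aestronglyMeasurable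
  have hvar : Var[g ∘ X 0; P] = Var[g; μ] := by
    rw [← (hlaw 0).map_eq, variance_map hgm.aemeasurable (hlaw 0).aemeasurable]
  have hLp : MemLp (g ∘ X 0) 2 P := by
    refine MemLp.comp_of_map ?_ (hlaw 0).aemeasurable
    rwa [(hlaw 0).map_eq]
  have hclt := tendstoInDistribution_inv_sqrt_mul_sum_sub (X := fun i ↦ g ∘ X i) (P := P)
    (Y := id) (P' := gaussianReal 0 Var[g ∘ X 0; P].toNNReal) HasLaw.id hLp
    (hindep.comp (fun _ ↦ g) fun _ ↦ hgm) (fun i ↦ by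
      refine IdentDistrib.comp ⟨(hlaw i).aemeasurable, (hlaw 0).aemeasurable, ?_⟩ hgm
      rw [(hlaw i).map_eq, (hlaw 0).map_eq])
  simp only [hint, hvar] at hclt
  convert hclt using 4 with n ω
  simp [empDev, Finset.sum_sub_distrib]

end

/-- The indicator of `(-∞, t]`; its empirical process is `√n (F_n(t) - F(t))`. -/
noncomputable def indIic (t : ℝ) : ℝ → ℝ := (Set.Iic t).indicator fun _ ↦ 1

lemma measurable_indIic (t : ℝ) : Measurable (indIic t) :=
  measurable_const.indicator measurableSet_Iic

section

variable {Ω : Type*} {μ : Measure ℝ} [IsProbabilityMeasure μ] {X : ℕ → Ω → ℝ}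

lemma memLp_indIic (t : ℝ) : MemLp (indIic t) 2 μ :=
  (memLp_const 1).indicator measurableSet_Iic

lemma integral_indIic (t : ℝ) : ∫ x, indIic t x ∂μ = cdf μ t := by
  rw [indIic, integral_indicator_const _ measurableSet_Iic, cdf_eq_real]
  simp

lemma indIic_mul (t u : ℝ) (x : ℝ) : indIic t x * indIic u x = indIic (min t u) x := by
  simp only [indIic, Set.indicator_apply, Set.mem_Iic, le_min_iff]
  split_ifs <;> simp_all

lemma covariance_indIic (t u : ℝ) :
    cov[indIic t, indIic u; μ] = cdf μ (min t u) - cdf μ t * cdf μ u := by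
  rw [covariance_eq_sub (memLp_indIic t) (memLp_indIic u), integral_indIic, integral_indIic]
  congr 1
  simp only [Pi.mul_apply, indIic_mul, integral_indIic]

lemma variance_indIic_sub_le (t u : ℝ) :
    Var[indIic t - indIic u; μ] ≤ |cdf μ t - cdf μ u| := by
  have h : ∀ x, (indIic t - indIic u) x ^ 2 = |indIic t x - indIic u x| := by
    intro x
    simp only [indIic, Pi.sub_apply, Set.indicator_apply]
    split_ifs <;> simp
  have hm := fun t ↦ (memLp_indIic (μ := μ) t).integrable one_le_two
  have h2 : ∀ t u, u ≤ t → ∫ x, |indIic t x - indIic u x| ∂μ = |cdf μ t - cdf μ u| := by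
    intro t u hut
    have : ∀ x, |indIic t x - indIic u x| = indIic t x - indIic u x := by
      intro x
      refine abs_of_nonneg ?_
      simp only [indIic, Set.indicator_apply, Set.mem_Iic]
      split_ifs with h1 h2 h2
      · norm_num
      · norm_num
      · exact absurd (h2.trans hut) h1
      · norm_num
    simp only [this]
    rw [integral_sub (hm t) (hm u), integral_indIic, integral_indIic,
      abs_of_nonneg (sub_nonneg.2 (monotone_cdf μ hut))]
  refine (variance_le_expectation_sq
    ((memLp_indIic t).sub (memLp_indIic u)).aestronglyMeasurable).trans_eq ?_
  simp only [Pi.pow_apply, h]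
  rcases le_total u t with hut | hut
  · exact h2 t u hut
  · simp only [abs_sub_comm (indIic t _), abs_sub_comm (cdf μ t)]
    exact h2 u t hut

lemma empDev_sub (n : ℕ) {g h : ℝ → ℝ} (hg : MemLp g 2 μ) (hh : MemLp h 2 μ) (ω : Ω) :
    empDev μ X n (g - h) ω = empDev μ X n g ω - empDev μ X n h ω := by
  simp only [empDev, ← mul_sub, ← Finset.sum_sub_distrib, Pi.sub_apply]
  rw [integral_sub (hg.integrable one_le_two) (hh.integrable one_le_two)]
  congr 1
  exact Finset.sum_congr rfl fun _ _ ↦ by ring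

lemma empDev_lin (n : ℕ) {g h : ℝ → ℝ} (hg : MemLp g 2 μ) (hh : MemLp h 2 μ) (a b : ℝ)
    (ω : Ω) :
    empDev μ X n (fun x ↦ a * g x + b * h x) ω =
      a * empDev μ X n g ω + b * empDev μ X n h ω := by
  simp only [empDev]
  rw [integral_add ((hg.integrable one_le_two).const_mul a)
    ((hh.integrable one_le_two).const_mul b), integral_const_mul, integral_const_mul,
    mul_left_comm a, mul_left_comm b, ← mul_add, Finset.mul_sum (a := a), Finset.mul_sum (a := b),
    ← Finset.sum_add_distrib]
  congr 1
  exact Finset.sum_congr rfl fun _ _ ↦ by ring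

/-- An order statistic is at most `t` exactly when the empirical process at `t` is at least the
centred and rescaled rank. -/
lemma orderStat_sample_le_iff {n i : ℕ} (hi : 1 ≤ i) (hin : i ≤ n) (t : ℝ) (ω : Ω) :
    orderStat (sample X n ω) i ≤ t ↔
      (√n)⁻¹ * (i - n * cdf μ t) ≤ empDev μ X n (indIic t) ω := by
  have hn : (0 : ℝ) < √n := Real.sqrt_pos.2 (by exact_mod_cast (by omega : 0 < n))
  have hsum : ((Finset.univ.filter fun j ↦ sample X n ω j ≤ t).card : ℝ) =
      ∑ j ∈ Finset.range n, indIic t (X j ω) := by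
    rw [← Fin.sum_univ_eq_sum_range (fun j ↦ indIic t (X j ω))]
    simp only [indIic, sample, Set.indicator_apply, Set.mem_Iic, Finset.sum_boole]
    congr!
  rw [orderStat_le_iff _ hi hin, ← Nat.cast_le (α := ℝ), hsum, empDev, integral_indIic,
    mul_le_mul_iff_right₀ (inv_pos.2 hn), Finset.sum_sub_distrib]
  simp

end

/-! ### Weak Bahadur representation of order statistics -/

/-- **Ghosh's lemma.** If `W` is tight and, for all `y < y'`, the probabilities that `y, y'`
separate `V` from `W` (in either order) tend to zero, then `V - W → 0` in probability. -/
lemma tendstoInMeasure_sub_of_separation {Ω : Type*} [MeasurableSpace Ω] {P : Measure Ω}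
    {V W : ℕ → Ω → ℝ}
    (htight : Tendsto (fun M : ℝ ↦ ⨆ k, P {ω | M ≤ |W k ω|}) atTop (𝓝 0))
    (hVW : ∀ y y', y < y' → Tendsto (fun k ↦ P {ω | V k ω ≤ y ∧ y' ≤ W k ω}) atTop (𝓝 0))
    (hWV : ∀ y y', y < y' → Tendsto (fun k ↦ P {ω | y' < V k ω ∧ W k ω ≤ y}) atTop (𝓝 0)) :
    TendstoInMeasure P (V - W) atTop 0 := by
  rw [tendstoInMeasure_iff_norm]
  intro ε hε
  simp only [Pi.sub_apply, Pi.zero_apply, sub_zero, Real.norm_eq_abs]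
  set η := ε / 3 with hη
  have hη0 : 0 < η := by positivity
  -- the grid `ηℤ ∩ [-Nη, Nη]`, fine enough to separate values at distance `3η`
  have hgrid : ∀ (N : ℕ) k, P {ω | ε ≤ |V k ω - W k ω|} ≤ (⨆ k, P {ω | (N : ℝ) * η ≤ |W k ω|}) +
      ∑ m ∈ Finset.Icc (-(N : ℤ)) N,
        (P {ω | V k ω ≤ (m - 2) * η ∧ m * η ≤ W k ω} +
          P {ω | (m + 2) * η < V k ω ∧ W k ω ≤ (m + 1) * η}) := by
    intro N k
    have hsub : {ω | ε ≤ |V k ω - W k ω|} ⊆ {ω | (N : ℝ) * η ≤ |W k ω|} ∪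
        ⋃ m ∈ Finset.Icc (-(N : ℤ)) N,
          ({ω | V k ω ≤ (m - 2) * η ∧ m * η ≤ W k ω} ∪
            {ω | (m + 2) * η < V k ω ∧ W k ω ≤ (m + 1) * η}) := by
      intro ω hω
      by_cases hN : (N : ℝ) * η ≤ |W k ω|
      · exact Or.inl hN
      right
      rw [not_le, abs_lt] at hN
      have hm1 : (⌊W k ω / η⌋ : ℝ) * η ≤ W k ω := by
        rw [← le_div_iff₀ hη0]
        exact Int.floor_le _
      have hm2 : W k ω < (⌊W k ω / η⌋ + 1) * η := by
        rw [← div_lt_iff₀ hη0]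
        exact Int.lt_floor_add_one _
      have hmem : ⌊W k ω / η⌋ ∈ Finset.Icc (-(N : ℤ)) N := by
        rw [Finset.mem_Icc]
        constructor
        · rw [Int.le_floor, le_div_iff₀ hη0]
          push_cast
          linarith
        · have : (⌊W k ω / η⌋ : ℝ) < N := by
            rw [← mul_lt_mul_iff_left₀ hη0]
            linarith
          exact_mod_cast this.le
      simp only [Set.mem_iUnion]
      refine ⟨⌊W k ω / η⌋, hmem, ?_⟩
      rcases le_abs.1 (show ε ≤ |V k ω - W k ω| from hω) with h | h
      · right
        exact ⟨by linarith, hm2.le⟩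
      · left
        exact ⟨by linarith, hm1⟩
    refine (measure_mono hsub).trans ((measure_union_le _ _).trans (add_le_add ?_ ?_))
    · exact le_iSup (fun k ↦ P {ω | (N : ℝ) * η ≤ |W k ω|}) k
    · exact (measure_biUnion_finset_le _ _).trans
        (Finset.sum_le_sum fun m _ ↦ measure_union_le _ _)
  have hsum : ∀ N : ℕ, Tendsto (fun k ↦ ∑ m ∈ Finset.Icc (-(N : ℤ)) N,
        (P {ω | V k ω ≤ (m - 2) * η ∧ m * η ≤ W k ω} +
          P {ω | (m + 2) * η < V k ω ∧ W k ω ≤ (m + 1) * η})) atTop (𝓝 0) := by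
    intro N
    rw [show (0 : ENNReal) = ∑ m ∈ Finset.Icc (-(N : ℤ)) N, (0 + 0) by simp]
    refine tendsto_finsetSum _ fun m _ ↦ (hVW _ _ ?_).add (hWV _ _ ?_) <;> linarith
  have hNt : Tendsto (fun N : ℕ ↦ ⨆ k, P {ω | (N : ℝ) * η ≤ |W k ω|}) atTop (𝓝 0) :=
    htight.comp (tendsto_natCast_atTop_atTop.atTop_mul_const hη0)
  rw [ENNReal.tendsto_nhds_zero]
  intro δ hδ
  have hδ2 : 0 < δ / 2 := ENNReal.half_pos hδ.ne'
  obtain ⟨N, hN⟩ := (ENNReal.tendsto_nhds_zero.1 hNt _ hδ2).exists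
  filter_upwards [ENNReal.tendsto_nhds_zero.1 (hsum N) _ hδ2] with k hk
  exact (hgrid N k).trans ((add_le_add hN hk).trans (ENNReal.add_halves δ).le)

lemma tendstoInMeasure_zero_lin {Ω : Type*} [MeasurableSpace Ω] {P : Measure Ω}
    {V W : ℕ → Ω → ℝ} (hV : TendstoInMeasure P V atTop 0)
    (hW : TendstoInMeasure P W atTop 0) (a b : ℝ) :
    TendstoInMeasure P (fun k ω ↦ a * V k ω + b * W k ω) atTop 0 := by
  rw [tendstoInMeasure_iff_norm] at *
  simp only [Pi.zero_apply, sub_zero, Real.norm_eq_abs] at *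
  intro ε hε
  set δ := ε / (2 * (|a| + |b| + 1)) with hδ
  have hpos : 0 < |a| + |b| + 1 := by positivity
  have hδ0 : 0 < δ := by positivity
  have hsum := (hV δ hδ0).add (hW δ hδ0)
  rw [add_zero] at hsum
  refine tendsto_of_tendsto_of_tendsto_of_le_of_le tendsto_const_nhds hsum
    (fun _ ↦ zero_le) fun k ↦ (measure_mono fun ω hω ↦ ?_).trans (measure_union_le _ _)
  by_contra hcon
  simp only [Set.mem_union, Set.mem_ofPred_eq, not_or, not_le] at hcon hω
  have h1 : |a * V k ω| ≤ |a| * δ := by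
    rw [abs_mul]
    exact mul_le_mul_of_nonneg_left hcon.1.le (abs_nonneg a)
  have h2 : |b * W k ω| ≤ |b| * δ := by
    rw [abs_mul]
    exact mul_le_mul_of_nonneg_left hcon.2.le (abs_nonneg b)
  have h3 : (|a| + |b| + 1) * δ = ε / 2 := by
    rw [hδ]
    field_simp
  have := abs_add_le (a * V k ω) (b * W k ω)
  nlinarith


/-- The quantile of order `p` is a solution of `F = p` as soon as `F` is continuous there. -/
lemma cdf_quantile (μ : Measure ℝ) {p : ℝ} (hp0 : 0 < p) (hp1 : p < 1)
    (hcont : ContinuousAt (fun x ↦ cdf μ x) (quantile μ p)) : cdf μ (quantile μ p) = p := by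
  obtain ⟨y, hy⟩ := ((tendsto_cdf_atBot μ).eventually (gt_mem_nhds hp0)).exists
  obtain ⟨z, hz⟩ := ((tendsto_cdf_atTop μ).eventually (lt_mem_nhds hp1)).exists
  have hbdd : BddBelow {x : ℝ | p ≤ cdf μ x} :=
    ⟨y, fun x hx ↦ le_of_not_gt fun hxy ↦ (hy.trans_le hx).not_ge (monotone_cdf μ hxy.le)⟩
  apply le_antisymm
  · refine le_of_tendsto (hcont.tendsto.mono_left (nhdsWithin_le_nhds (s := Set.Iio (quantile μ p)))) ?_
    filter_upwards [self_mem_nhdsWithin] with x hx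
    exact le_of_not_ge fun h ↦ (csInf_le hbdd h).not_gt hx
  · refine ge_of_tendsto (hcont.tendsto.mono_left (nhdsWithin_le_nhds (s := Set.Ioi (quantile μ p)))) ?_
    filter_upwards [self_mem_nhdsWithin] with x hx
    obtain ⟨u, hu, hux⟩ := exists_lt_of_csInf_lt ⟨z, hz.le⟩ (show sInf _ < x from hx)
    exact le_trans hu (monotone_cdf μ hux.le)

section

variable {Ω : Type*} [MeasurableSpace Ω] {P : Measure Ω} [IsProbabilityMeasure P]
  {μ : Measure ℝ} [IsProbabilityMeasure μ] {X : ℕ → Ω → ℝ}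

/-- If `F` is continuous at `q`, the empirical process is stochastically equicontinuous
there. -/
lemma tendsto_measure_le_abs_empDev_sub (hlaw : ∀ i, HasLaw (X i) μ P)
    (hindep : iIndepFun X P) {q : ℝ} (hcont : ContinuousAt (fun x ↦ cdf μ x) q) {t : ℕ → ℝ}
    (ht : Tendsto t atTop (𝓝 q)) (n : ℕ → ℕ) {ε : ℝ} (hε : 0 < ε) :
    Tendsto (fun k ↦ P {ω | ε ≤ |empDev μ X (n k) (indIic (t k)) ω -
      empDev μ X (n k) (indIic q) ω|}) atTop (𝓝 0) := by
  have hlim : Tendsto (fun k ↦ ENNReal.ofReal (|cdf μ (t k) - cdf μ q| / ε ^ 2)) atTop (𝓝 0) := by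
    have := (((hcont.tendsto.comp ht).sub_const (cdf μ q)).abs).div_const (ε ^ 2)
    simpa using ENNReal.tendsto_ofReal this
  refine tendsto_of_tendsto_of_tendsto_of_le_of_le tendsto_const_nhds hlim
    (fun _ ↦ zero_le) fun k ↦ ?_
  simp only [← empDev_sub (n k) (memLp_indIic (μ := μ) (t k)) (memLp_indIic q)]
  refine (measure_le_abs_empDev hlaw hindep ((measurable_indIic _).sub (measurable_indIic _))
    ((memLp_indIic _).sub (memLp_indIic _)) _ hε).trans (ENNReal.ofReal_le_ofReal ?_)
  gcongr
  exact variance_indIic_sub_le _ _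

/-- **Weak Bahadur representation.** If `F(q) = p` and `F` has derivative `c > 0` at `q`, then an
order statistic of rank `np + o(√n)` satisfies
`√n (X_(i) - q) = -√n (F_n(q) - F(q)) / c + o_P(1)`. -/
theorem tendstoInMeasure_orderStat_sub_empDev (hlaw : ∀ i, HasLaw (X i) μ P)
    (hindep : iIndepFun X P) {q c : ℝ} (hc : 0 < c) (hF : HasDerivAt (fun x ↦ cdf μ x) c q)
    {n i : ℕ → ℕ} (hn : Tendsto n atTop atTop) (hi : ∀ᶠ k in atTop, 1 ≤ i k ∧ i k ≤ n k)
    (hrank : Tendsto (fun k ↦ (√(n k))⁻¹ * (i k - n k * cdf μ q)) atTop (𝓝 0)) :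
    TendstoInMeasure P
      ((fun k ω ↦ √(n k) * (orderStat (sample X (n k) ω) (i k) - q)) -
        fun k ω ↦ -c⁻¹ * empDev μ X (n k) (indIic q) ω) atTop 0 := by
  have hs : Tendsto (fun k ↦ √(n k : ℝ)) atTop atTop :=
    Real.tendsto_sqrt_atTop.comp (tendsto_natCast_atTop_atTop.comp hn)
  have hs0 : ∀ᶠ k in atTop, 0 < √(n k : ℝ) := hs.eventually_gt_atTop 0
  have ht : ∀ y : ℝ, Tendsto (fun k ↦ q + y / √(n k)) atTop (𝓝 q) := fun y ↦ by
    simpa using (tendsto_const_nhds (x := y)).div_atTop hs |>.const_add q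
  -- the rescaled centred ranks at `q + y / √n` converge to `-c y`
  have hy : ∀ y : ℝ, Tendsto
      (fun k ↦ (√(n k))⁻¹ * (i k - n k * cdf μ (q + y / √(n k)))) atTop (𝓝 (-(c * y))) := by
    intro y
    have hslope : Tendsto (fun k ↦ √(n k) * (cdf μ (q + y / √(n k)) - cdf μ q)) atTop
        (𝓝 (c * y)) := by
      have h := hF.hasFDerivAt.lim y (c := fun k ↦ √(n k : ℝ)) (l := atTop)
        (tendsto_norm_atTop_atTop.comp hs)
      simpa [mul_comm, div_eq_mul_inv] using h
    have h := hrank.sub hslope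
    rw [zero_sub] at h
    refine h.congr' ?_
    filter_upwards [hs0] with k hk
    have h3 : (√(n k : ℝ))⁻¹ * n k = √(n k) := by
      rw [inv_mul_eq_div, Real.div_sqrt]
    linear_combination (cdf μ (q + y / √(n k)) - cdf μ q) * h3
  have hV : ∀ y : ℝ, ∀ᶠ k in atTop, ∀ ω, √(n k) * (orderStat (sample X (n k) ω) (i k) - q) ≤ y ↔
      (√(n k))⁻¹ * (i k - n k * cdf μ (q + y / √(n k))) ≤
        empDev μ X (n k) (indIic (q + y / √(n k))) ω := by
    intro y
    filter_upwards [hs0, hi] with k hk hik ω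
    rw [← orderStat_sample_le_iff hik.1 hik.2, ← sub_le_iff_le_add', le_div_iff₀ hk, mul_comm]
  have hosc : ∀ y ε : ℝ, 0 < ε → Tendsto (fun k ↦ P {ω | ε ≤
      |empDev μ X (n k) (indIic (q + y / √(n k))) ω - empDev μ X (n k) (indIic q) ω|})
      atTop (𝓝 0) := fun y ε hε ↦
    tendsto_measure_le_abs_empDev_sub hlaw hindep hF.continuousAt (ht y) n hε
  refine tendstoInMeasure_sub_of_separation ?_ ?_ ?_
  · have hlim : Tendsto (fun M : ℝ ↦ ENNReal.ofReal (Var[indIic q; μ] / (c * M) ^ 2)) atTop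
        (𝓝 0) := by
      have h1 : Tendsto (fun M : ℝ ↦ (c * M) ^ 2) atTop atTop :=
        (tendsto_pow_atTop two_ne_zero).comp (tendsto_id.const_mul_atTop hc)
      simpa using ENNReal.tendsto_ofReal ((tendsto_const_nhds (x := Var[indIic q; μ])).div_atTop h1)
    refine tendsto_of_tendsto_of_tendsto_of_le_of_le' tendsto_const_nhds hlim
      (.of_forall fun _ ↦ zero_le) ?_
    filter_upwards [eventually_gt_atTop 0] with M hM
    refine iSup_le fun k ↦ le_trans (measure_mono fun ω hω ↦ ?_)
      (measure_le_abs_empDev hlaw hindep (measurable_indIic q) (memLp_indIic q) (n k)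
        (mul_pos hc hM))
    simp only [Set.mem_ofPred_eq, neg_mul, abs_neg, abs_mul, abs_inv, abs_of_pos hc] at hω ⊢
    rwa [inv_mul_eq_div, le_div_iff₀ hc, mul_comm] at hω
  · intro y y' hyy
    have hgap : 0 < c * (y' - y) / 2 := by have := sub_pos.2 hyy; positivity
    refine tendsto_of_tendsto_of_tendsto_of_le_of_le' tendsto_const_nhds (hosc y _ hgap)
      (.of_forall fun _ ↦ zero_le) ?_
    filter_upwards [hV y, (hy y).eventually (lt_mem_nhds (sub_lt_self _ hgap))] with k hk hky
    refine measure_mono fun ω hω ↦ ?_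
    obtain ⟨h1, h2⟩ := hω
    rw [hk] at h1
    rw [neg_mul, inv_mul_eq_div, ← neg_div, le_div_iff₀ hc] at h2
    rw [Set.mem_ofPred_eq]
    refine le_trans ?_ (le_abs_self _)
    linarith
  · intro y y' hyy
    have hgap : 0 < c * (y' - y) / 2 := by have := sub_pos.2 hyy; positivity
    refine tendsto_of_tendsto_of_tendsto_of_le_of_le' tendsto_const_nhds (hosc y' _ hgap)
      (.of_forall fun _ ↦ zero_le) ?_
    filter_upwards [hV y', (hy y').eventually (gt_mem_nhds (lt_add_of_pos_right _ hgap))]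
      with k hk hky
    refine measure_mono fun ω hω ↦ ?_
    obtain ⟨h1, h2⟩ := hω
    rw [← not_le, hk, not_le] at h1
    rw [neg_mul, inv_mul_eq_div, ← neg_div, div_le_iff₀ hc] at h2
    rw [Set.mem_ofPred_eq]
    refine le_trans ?_ (neg_le_abs _)
    linarith

end

/-! ### Asymptotic normality of linear combinations of two order statistics -/

section

variable {Ω : Type*} [MeasurableSpace Ω] {P : Measure Ω} [IsProbabilityMeasure P]
  {μ : Measure ℝ} [IsProbabilityMeasure μ] {X : ℕ → Ω → ℝ}

/-- Joint asymptotic normality of two order statistics, in the form of a central limit theorem for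
their linear combinations. -/
theorem tendstoNormal_orderStat_lin (hlaw : ∀ i, HasLaw (X i) μ P) (hindep : iIndepFun X P)
    {q r c d : ℝ} (hqr : q ≤ r) (hc : 0 < c) (hd : 0 < d)
    (hFq : HasDerivAt (fun x ↦ cdf μ x) c q) (hFr : HasDerivAt (fun x ↦ cdf μ x) d r)
    {n i j : ℕ → ℕ} (hn : Tendsto n atTop atTop)
    (hi : ∀ᶠ k in atTop, 1 ≤ i k ∧ i k ≤ n k) (hj : ∀ᶠ k in atTop, 1 ≤ j k ∧ j k ≤ n k)
    (hir : Tendsto (fun k ↦ (√(n k))⁻¹ * (i k - n k * cdf μ q)) atTop (𝓝 0))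
    (hjr : Tendsto (fun k ↦ (√(n k))⁻¹ * (j k - n k * cdf μ r)) atTop (𝓝 0)) (a b : ℝ) :
    TendstoNormal P
      (fun k ω ↦ √(n k) * ((a * orderStat (sample X (n k) ω) (i k) +
        b * orderStat (sample X (n k) ω) (j k)) - (a * q + b * r)))
      ((a / c) ^ 2 * (cdf μ q * (1 - cdf μ q)) + 2 * (a / c) * (b / d) * (cdf μ q * (1 - cdf μ r))
        + (b / d) ^ 2 * (cdf μ r * (1 - cdf μ r))) := by
  set g : ℝ → ℝ := fun x ↦ (-(a / c)) * indIic q x + (-(b / d)) * indIic r x with hg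
  have hgm : Measurable g :=
    ((measurable_indIic q).const_mul _).add ((measurable_indIic r).const_mul _)
  have hg1 : MemLp (fun x ↦ (-(a / c)) * indIic q x) 2 μ := (memLp_indIic q).const_mul _
  have hg2 : MemLp (fun x ↦ (-(b / d)) * indIic r x) 2 μ := (memLp_indIic r).const_mul _
  have hgL : MemLp g 2 μ := hg1.add hg2
  have hX := fun i ↦ (hlaw i).aemeasurable
  have hvar : Var[g; μ] = (a / c) ^ 2 * (cdf μ q * (1 - cdf μ q)) +
      2 * (a / c) * (b / d) * (cdf μ q * (1 - cdf μ r)) +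
      (b / d) ^ 2 * (cdf μ r * (1 - cdf μ r)) := by
    rw [hg, variance_fun_add hg1 hg2, covariance_const_mul_left, covariance_const_mul_right,
      variance_const_mul, variance_const_mul,
      ← covariance_self (measurable_indIic q).aemeasurable,
      ← covariance_self (measurable_indIic r).aemeasurable,
      covariance_indIic, covariance_indIic, covariance_indIic, min_self, min_self, min_eq_left hqr]
    ring
  refine ⟨Var[g; μ].toNNReal, ?_, ?_⟩
  · rw [Real.coe_toNNReal _ (variance_nonneg _ _), hvar]
  have hclt := tendstoInDistribution_empDev hlaw hindep hgm hgL
  have hclt' : TendstoInDistribution (fun k ↦ empDev μ X (n k) g) atTop (id : ℝ → ℝ)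
      (fun _ ↦ P) (gaussianReal 0 Var[g; μ].toNNReal) :=
    ⟨fun k ↦ hclt.forall_aemeasurable (n k), hclt.aemeasurable_limit, hclt.tendsto.comp hn⟩
  refine tendstoInDistribution_of_tendstoInMeasure_sub _ _ hclt' ?_ fun k ↦ ?_
  · have h := tendstoInMeasure_zero_lin
      (tendstoInMeasure_orderStat_sub_empDev hlaw hindep hc hFq hn hi hir)
      (tendstoInMeasure_orderStat_sub_empDev hlaw hindep hd hFr hn hj hjr) a b
    convert h using 1
    ext k ω
    simp only [Pi.sub_apply]
    rw [hg, empDev_lin (n k) (memLp_indIic q) (memLp_indIic r)]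
    ring
  · exact ((((aemeasurable_orderStat_sample hX _ _).const_mul a).add
      ((aemeasurable_orderStat_sample hX _ _).const_mul b)).sub_const _).const_mul _

/-- Weak consistency of order statistics. -/
lemma tendsto_measure_lt_abs_orderStat_sub (hlaw : ∀ i, HasLaw (X i) μ P)
    (hindep : iIndepFun X P) {q c : ℝ} (hc : 0 < c) (hF : HasDerivAt (fun x ↦ cdf μ x) c q)
    {n i : ℕ → ℕ} (hn : Tendsto n atTop atTop) (hi : ∀ᶠ k in atTop, 1 ≤ i k ∧ i k ≤ n k)
    (hrank : Tendsto (fun k ↦ (√(n k))⁻¹ * (i k - n k * cdf μ q)) atTop (𝓝 0))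
    {t : ℝ} (ht : 0 < t) :
    Tendsto (fun k ↦ P {ω | t < |orderStat (sample X (n k) ω) (i k) - q|}) atTop (𝓝 0) := by
  have hs : Tendsto (fun k ↦ √(n k : ℝ)) atTop atTop :=
    Real.tendsto_sqrt_atTop.comp (tendsto_natCast_atTop_atTop.comp hn)
  have hB := tendstoInMeasure_orderStat_sub_empDev hlaw hindep hc hF hn hi hrank
  rw [tendstoInMeasure_iff_norm] at hB
  have hB1 := hB 1 one_pos
  simp only [Pi.sub_apply, Pi.zero_apply, sub_zero, Real.norm_eq_abs] at hB1
  have hst : Tendsto (fun k ↦ c * (t * √(n k : ℝ) - 1)) atTop atTop :=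
    (tendsto_atTop_add_const_right _ (-1) (hs.const_mul_atTop ht)).const_mul_atTop hc
  have hlim : Tendsto (fun k ↦ ENNReal.ofReal
      (Var[indIic q; μ] / (c * (t * √(n k : ℝ) - 1)) ^ 2)) atTop (𝓝 0) := by
    simpa using ENNReal.tendsto_ofReal ((tendsto_const_nhds (x := Var[indIic q; μ])).div_atTop
      ((tendsto_pow_atTop two_ne_zero).comp hst))
  have hsum := hB1.add hlim
  rw [add_zero] at hsum
  refine tendsto_of_tendsto_of_tendsto_of_le_of_le' tendsto_const_nhds hsum
    (.of_forall fun _ ↦ zero_le) ?_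
  filter_upwards [hst.eventually_gt_atTop 0, hs.eventually_gt_atTop 0] with k hk hk0
  refine le_trans ((measure_mono fun ω hω ↦ ?_).trans (measure_union_le _ _))
    (add_le_add_right (measure_le_abs_empDev hlaw hindep (measurable_indIic q)
      (memLp_indIic q) (n k) hk) _)
  by_contra hcon
  simp only [Set.mem_union, Set.mem_ofPred_eq, not_or, not_le] at hcon hω
  obtain ⟨h1, h2⟩ := hcon
  have h3 : |-c⁻¹ * empDev μ X (n k) (indIic q) ω| < t * √(n k) - 1 := by
    rw [abs_mul, abs_neg, abs_inv, abs_of_pos hc, inv_mul_eq_div, div_lt_iff₀ hc]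
    linarith
  have h4 : t * √(n k) < |√(n k) * (orderStat (sample X (n k) ω) (i k) - q)| := by
    rw [abs_mul, abs_of_pos hk0, mul_comm]
    gcongr
  have h5 := abs_sub_abs_le_abs_sub (√(n k) * (orderStat (sample X (n k) ω) (i k) - q))
    (-c⁻¹ * empDev μ X (n k) (indIic q) ω)
  linarith

end

/-! ### Convergence of means from tail bounds -/

/-- Convergence in probability to a constant together with uniform quadratic tail bounds gives
convergence in `L¹`. -/
lemma tendsto_lintegral_abs_sub_of_tail_le {Ω : Type*} [MeasurableSpace Ω] {P : Measure Ω}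
    [IsProbabilityMeasure P] {Y : ℕ → Ω → ℝ} (hY : ∀ k, AEMeasurable (Y k) P) {q T : ℝ}
    (hT : 0 < T) (hprob : ∀ t, 0 < t → Tendsto (fun k ↦ P {ω | t < |Y k ω - q|}) atTop (𝓝 0))
    (htail : ∀ᶠ k in atTop, ∀ t, T ≤ t → P {ω | t < |Y k ω|} ≤ ENNReal.ofReal ((T / t) ^ 2)) :
    Tendsto (fun k ↦ ∫⁻ ω, ENNReal.ofReal |Y k ω - q| ∂P) atTop (𝓝 0) := by
  have hlayer : ∀ k, ∫⁻ ω, ENNReal.ofReal |Y k ω - q| ∂P =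
      ∫⁻ t in Set.Ioi 0, P {ω | t < |Y k ω - q|} := fun k ↦
    lintegral_eq_lintegral_meas_lt P (.of_forall fun _ ↦ abs_nonneg _)
      (measurable_norm.comp_aemeasurable ((hY k).sub_const q))
  simp only [hlayer]
  -- for `t > R` the event `t < |Y - q|` forces `t / 2 < |Y|`, with `t / 2 ≥ T`
  set R := 2 * T + 2 * |q| with hR
  have hR0 : 0 < R := by positivity
  rw [show (0 : ENNReal) = ∫⁻ _ in Set.Ioi (0 : ℝ), 0 by simp]
  refine tendsto_lintegral_filter_of_dominated_convergence
    (fun t ↦ ENNReal.ofReal ((1 + R ^ 2) * (1 + t ^ 2)⁻¹)) (.of_forall fun k ↦ ?_) ?_ ?_ ?_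
  · exact Antitone.measurable fun t u htu ↦ measure_mono fun ω hω ↦ lt_of_le_of_lt htu hω
  · filter_upwards [htail] with k hk
    filter_upwards [ae_restrict_mem measurableSet_Ioi] with t ht
    rw [Set.mem_Ioi] at ht
    rcases le_or_gt t R with htR | htR
    · refine prob_le_one.trans ?_
      rw [ENNReal.one_le_ofReal, ← div_eq_mul_inv, one_le_div (by positivity)]
      gcongr
    · have hq := abs_nonneg q
      have hsub : {ω | t < |Y k ω - q|} ⊆ {ω | t / 2 < |Y k ω|} := by
        intro ω hω
        rw [Set.mem_ofPred_eq] at hω ⊢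
        have := abs_sub (Y k ω) q
        linarith
      refine (measure_mono hsub).trans ((hk (t / 2) (by linarith)).trans
        (ENNReal.ofReal_le_ofReal ?_))
      have h1 : (T / (t / 2)) ^ 2 ≤ (R / t) ^ 2 := by
        rw [div_div_eq_mul_div, mul_comm T]
        gcongr
        linarith
      refine h1.trans ?_
      rw [← div_eq_mul_inv, div_pow, div_le_div_iff₀ (by positivity) (by positivity)]
      have : R ^ 2 ≤ t ^ 2 := by gcongr
      linarith
  · have hint : Integrable (fun t : ℝ ↦ (1 + R ^ 2) * (1 + t ^ 2)⁻¹) :=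
      integrable_inv_one_add_sq.const_mul _
    refine ne_of_lt (lt_of_le_of_lt (setLIntegral_le_lintegral _ _) ?_)
    exact hint.lintegral_lt_top
  · filter_upwards [ae_restrict_mem measurableSet_Ioi] with t ht
    exact hprob t ht

lemma integrable_and_tendsto_integral_of_lintegral_abs_sub {Ω : Type*} [MeasurableSpace Ω]
    {P : Measure Ω} [IsProbabilityMeasure P] {Y : ℕ → Ω → ℝ} (hY : ∀ k, AEMeasurable (Y k) P)
    {q : ℝ} (h : Tendsto (fun k ↦ ∫⁻ ω, ENNReal.ofReal |Y k ω - q| ∂P) atTop (𝓝 0)) :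
    (∀ᶠ k in atTop, Integrable (Y k) P) ∧ Tendsto (fun k ↦ ∫ ω, Y k ω ∂P) atTop (𝓝 q) := by
  have heq : ∀ k, ∫⁻ ω, ENNReal.ofReal |Y k ω - q| ∂P = ∫⁻ ω, ‖Y k ω - q‖ₑ ∂P := fun k ↦ by
    simp only [← Real.norm_eq_abs, ofReal_norm]
  simp only [heq] at h
  have hint : ∀ᶠ k in atTop, Integrable (Y k) P := by
    filter_upwards [h.eventually (gt_mem_nhds ENNReal.zero_lt_top)] with k hk
    have : Integrable (fun ω ↦ Y k ω - q) P :=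
      ⟨((hY k).sub_const q).aestronglyMeasurable, hk⟩
    exact (this.add (integrable_const q)).congr (.of_forall fun ω ↦ by simp)
  refine ⟨hint, ?_⟩
  simpa using tendsto_integral_of_L1 (fun _ : Ω ↦ q) (by fun_prop) hint h

/-! ### Tails of the law and tails of order statistics -/

section

variable {Ω : Type*} [MeasurableSpace Ω] {P : Measure Ω} {μ : Measure ℝ} {X : ℕ → Ω → ℝ}

/-- A union bound over the sets of `m` observations that could all exceed `t` in absolute
value. -/
lemma measure_lt_abs_orderStat_le (hlaw : ∀ i, HasLaw (X i) μ P) (hindep : iIndepFun X P)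
    {n i m : ℕ} (hi : 1 ≤ i) (hin : i ≤ n) (hmi : m ≤ i) (hmn : m + i ≤ n + 1) (t : ℝ) :
    P {ω | t < |orderStat (sample X n ω) i|} ≤ 2 ^ n * μ {x | t < |x|} ^ m := by
  have hmeas : MeasurableSet {x : ℝ | t < |x|} :=
    measurableSet_lt measurable_const measurable_norm
  have hsub : {ω | t < |orderStat (sample X n ω) i|} ⊆
      ⋃ S ∈ Finset.powersetCard m (Finset.range n), ⋂ j ∈ S, X j ⁻¹' {x | t < |x|} := by
    intro ω hω
    have hcard := le_card_of_lt_abs_orderStat _ hi hin hmi hmn hω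
    obtain ⟨S, hS, hSm⟩ := Finset.exists_subset_card_eq hcard
    simp only [Set.mem_iUnion, Set.mem_iInter]
    refine ⟨S.map Fin.valEmbedding, ?_, fun j hj ↦ ?_⟩
    · rw [Finset.mem_powersetCard, Finset.card_map]
      refine ⟨fun j hj ↦ ?_, hSm⟩
      obtain ⟨l, _, rfl⟩ := Finset.mem_map.1 hj
      simp
    · obtain ⟨l, hl, rfl⟩ := Finset.mem_map.1 hj
      exact (Finset.mem_filter.1 (hS hl)).2
  refine (measure_mono hsub).trans ((measure_biUnion_finset_le _ _).trans ?_)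
  have hterm : ∀ S ∈ Finset.powersetCard m (Finset.range n),
      P (⋂ j ∈ S, X j ⁻¹' {x | t < |x|}) = μ {x | t < |x|} ^ m := by
    intro S hS
    rw [hindep.measure_inter_preimage_eq_mul S fun _ _ ↦ hmeas,
      Finset.prod_congr rfl fun j _ ↦ show P (X j ⁻¹' {x | t < |x|}) = μ {x | t < |x|} from
        (hlaw j).measure_eq hmeas, Finset.prod_const,
      (Finset.mem_powersetCard.1 hS).2]
  rw [Finset.sum_congr rfl hterm, Finset.sum_const, nsmul_eq_mul, Finset.card_powersetCard,
    Finset.card_range]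
  gcongr
  exact_mod_cast Nat.choose_le_two_pow n m

lemma measureReal_forall_mem (hlaw : ∀ i, HasLaw (X i) μ P) (hindep : iIndepFun X P)
    {A B : Set ℝ} (hA : MeasurableSet A) (hB : MeasurableSet B) {k n : ℕ} (hkn : k ≤ n) :
    P.real {ω | ∀ j < n, (j < k → X j ω ∈ A) ∧ (k ≤ j → X j ω ∈ B)} =
      μ.real A ^ k * μ.real B ^ (n - k) := by
  classical
  have heq : {ω | ∀ j < n, (j < k → X j ω ∈ A) ∧ (k ≤ j → X j ω ∈ B)} =
      ⋂ j ∈ Finset.range n, X j ⁻¹' (if j < k then A else B) := by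
    ext ω
    simp only [Set.mem_ofPred_eq, Set.mem_iInter, Finset.mem_range, Set.mem_preimage]
    refine forall₂_congr fun j _ ↦ ?_
    split_ifs with h
    · simp [h]
    · simp [h, not_lt.1 h]
  have hm : ∀ j, MeasurableSet (if j < k then A else B) := fun j ↦ by split_ifs <;> assumption
  rw [heq, measureReal_def, hindep.measure_inter_preimage_eq_mul _ fun j _ ↦ hm j,
    ENNReal.toReal_prod, ← Finset.prod_range_mul_prod_Ico _ hkn]
  have hterm : ∀ j, (P (X j ⁻¹' (if j < k then A else B))).toReal =
      μ.real (if j < k then A else B) := fun j ↦ (hlaw j).measureReal_eq (hm j)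
  simp only [hterm]
  congr 1
  · rw [Finset.prod_congr rfl fun j hj ↦ by rw [if_pos (Finset.mem_range.1 hj)]]
    simp
  · rw [Finset.prod_congr rfl fun j hj ↦ by rw [if_neg (not_lt.2 (Finset.mem_Ico.1 hj).1)]]
    simp

end

lemma add_size {s k : ℕ} (hk : 1 ≤ k) : size s k + 1 = s * k + k := by
  have : 1 ≤ (s + 1) * k := Nat.mul_pos (Nat.succ_pos s) hk
  rw [size, Nat.sub_add_cancel this, Nat.succ_mul]

lemma card_filter_val_lt {n k : ℕ} (hkn : k ≤ n) :
    (Finset.univ.filter fun j : Fin n ↦ (j : ℕ) < k).card = k := by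
  rw [Fin.card_filter_val_lt, min_eq_right hkn]

/-- If the first `k` observations of a sample of size `(s+1)k-1` exceed `t ≥ M` and all others lie
in `(-M, M]`, then the order statistic of rank `sk` exceeds `t`, while for `s ≥ 2` the one of
rank `k` stays bounded. -/
lemma orderStat_of_large {s k : ℕ} (hs : 1 ≤ s) (hk : 1 ≤ k) {x : Fin (size s k) → ℝ} {t M : ℝ}
    (htM : M ≤ t) (hM : 0 ≤ M) (hx : ∀ j : Fin (size s k), ((j : ℕ) < k → x j ∈ Set.Ioi t) ∧
      (k ≤ (j : ℕ) → x j ∈ Set.Ioc (-M) M)) :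
    t < orderStat x (s * k) ∧ (2 ≤ s → |orderStat x k| ≤ M) := by
  have hsz := add_size (s := s) hk
  have hsk : k ≤ s * k := Nat.le_mul_of_pos_left k hs
  have hkn : k ≤ size s k := by omega
  have hlt := card_filter_val_lt hkn
  have hge := Finset.card_filter_add_card_filter_not (s := Finset.univ)
    (fun j : Fin (size s k) ↦ (j : ℕ) < k)
  rw [hlt, Finset.card_univ, Fintype.card_fin] at hge
  constructor
  · rw [← not_le, orderStat_le_iff x (by omega) (by omega)]
    have : (Finset.univ.filter fun j ↦ x j ≤ t).card ≤
        (Finset.univ.filter fun j : Fin (size s k) ↦ ¬ (j : ℕ) < k).card :=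
      Finset.card_le_card <| Finset.monotone_filter_right _ fun j _ hj hjk ↦
        hj.not_gt ((hx j).1 hjk)
    omega
  · intro hs2
    have hsk2 : 2 * k ≤ s * k := Nat.mul_le_mul_right k hs2
    rw [abs_le]
    constructor
    · obtain ⟨j, hj⟩ := exists_orderStat_eq x hk hkn
      rw [hj]
      rcases lt_or_ge (j : ℕ) k with h | h
      · have := Set.mem_Ioi.1 ((hx j).1 h)
        linarith
      · exact ((hx j).2 h).1.le
    · rw [orderStat_le_iff x hk hkn]
      have : (Finset.univ.filter fun j : Fin (size s k) ↦ ¬ (j : ℕ) < k).card ≤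
          (Finset.univ.filter fun j ↦ x j ≤ M).card :=
        Finset.card_le_card <| Finset.monotone_filter_right _ fun j _ hj ↦
          ((hx j).2 (not_lt.1 hj)).2
      omega

/-- The counterpart of `orderStat_of_large` for the lower tail, with the two ranks exchanged. -/
lemma orderStat_of_small {s k : ℕ} (hs : 1 ≤ s) (hk : 1 ≤ k) {x : Fin (size s k) → ℝ} {t M : ℝ}
    (htM : M ≤ t) (hM : 0 ≤ M) (hx : ∀ j : Fin (size s k), ((j : ℕ) < k → x j ∈ Set.Iio (-t)) ∧
      (k ≤ (j : ℕ) → x j ∈ Set.Ioc (-M) M)) :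
    orderStat x k ≤ -t ∧ (2 ≤ s → |orderStat x (s * k)| ≤ M) := by
  have hsz := add_size (s := s) hk
  have hsk : k ≤ s * k := Nat.le_mul_of_pos_left k hs
  have hkn : k ≤ size s k := by omega
  have hlt := card_filter_val_lt hkn
  constructor
  · rw [orderStat_le_iff x hk hkn]
    conv_lhs => rw [← hlt]
    exact Finset.card_le_card <| Finset.monotone_filter_right _ fun j _ hj ↦
      (Set.mem_Iio.1 ((hx j).1 hj)).le
  · intro hs2
    have hsk2 : 2 * k ≤ s * k := Nat.mul_le_mul_right k hs2
    rw [abs_le]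
    constructor
    · refine le_of_not_ge fun hcon ↦ ?_
      rw [orderStat_le_iff x (by omega) (by omega)] at hcon
      have : (Finset.univ.filter fun j ↦ x j ≤ -M).card ≤
          (Finset.univ.filter fun j : Fin (size s k) ↦ (j : ℕ) < k).card :=
        Finset.card_le_card <| Finset.monotone_filter_right _ fun j _ hj ↦
          lt_of_not_ge fun hjk ↦ hj.not_gt ((hx j).2 hjk).1
      omega
    · obtain ⟨j, hj⟩ := exists_orderStat_eq x (i := s * k) (by omega) (by omega)
      rw [hj]
      rcases lt_or_ge (j : ℕ) k with h | h
      · have := Set.mem_Iio.1 ((hx j).1 h)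
        linarith
      · exact ((hx j).2 h).2

/-- A linear combination whose dominant term is at least `t` in absolute value, the other being
bounded by `M`, is at least a fixed proportion of `t`. -/
lemma mul_le_abs_lin {a b u v t M : ℝ} (hu : t ≤ |u|) (hv : |v| ≤ M)
    (ht : 2 * |b| * M ≤ |a| * t) : |a| / 2 * t ≤ |a * u + b * v| := by
  have h1 : |a| * t ≤ |a * u| := by
    rw [abs_mul]
    gcongr
  have h2 : |b * v| ≤ |b| * M := by
    rw [abs_mul]
    gcongr
  have h3 := abs_sub_abs_le_abs_sub (a * u) (-(b * v))
  rw [abs_neg, sub_neg_eq_add] at h3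
  linarith

section

variable {Ω : Type*} [MeasurableSpace Ω] {P : Measure Ω}
  {μ : Measure ℝ} [IsProbabilityMeasure μ] {X : ℕ → Ω → ℝ}

/-- Integrability of a combination `a X_(k) + b X_(sk)` controls the tail of the law: with `k`
observations beyond `±t` and the others bounded, the combination has size of order `t`, so that
`P(|X| > t)^k = O(1/t)` by Markov's inequality. -/
lemma exists_tail_bound_of_integrable [IsProbabilityMeasure P]
    (hlaw : ∀ i, HasLaw (X i) μ P) (hindep : iIndepFun X P)
    {s k : ℕ} (hs : 1 ≤ s) (hk : 1 ≤ k) {a b : ℝ} (ha : a ≠ 0) (hb : b ≠ 0) (hab : a + b = 1)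
    (hint : Integrable (fun ω ↦ a * orderStat (sample X (size s k) ω) k +
      b * orderStat (sample X (size s k) ω) (s * k)) P) :
    ∃ C, 0 < C ∧ ∀ t, 0 < t → t * μ.real {x | t < |x|} ^ k ≤ C := by
  set T : Ω → ℝ := fun ω ↦ a * orderStat (sample X (size s k) ω) k +
      b * orderStat (sample X (size s k) ω) (s * k) with hT
  have hsz := add_size (s := s) hk
  have hsk : k ≤ s * k := Nat.le_mul_of_pos_left k hs
  have hkn : k ≤ size s k := by omega
  have ha0 := abs_pos.2 ha
  have hb0 := abs_pos.2 hb
  -- a bounded interval of positive mass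
  obtain ⟨M, hM0, hM⟩ : ∃ M : ℝ, 0 < M ∧ 0 < μ.real (Set.Ioc (-M) M) := by
    by_contra! hcon
    have h0 : ∀ m : ℕ, μ (Set.Ioc (-((m : ℝ) + 1)) ((m : ℝ) + 1)) = 0 := fun m ↦ by
      have := le_antisymm (hcon (m + 1) (by positivity)) measureReal_nonneg
      rwa [measureReal_eq_zero_iff] at this
    have huniv : (Set.univ : Set ℝ) ⊆ ⋃ m : ℕ, Set.Ioc (-((m : ℝ) + 1)) ((m : ℝ) + 1) := by
      intro x _
      obtain ⟨m, hm⟩ := exists_nat_ge |x|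
      rw [Set.mem_iUnion]
      have := abs_le.1 hm
      exact ⟨m, by linarith, by linarith⟩
    have := measure_mono_null huniv (measure_iUnion_null h0)
    simp at this
  -- `κ t` is a lower bound for the statistic in all cases; the `1` serves `s = 1`, where the
  -- statistic is a single order statistic
  set κ : ℝ := min (min (|a| / 2) (|b| / 2)) 1 with hκ
  have hκ0 : 0 < κ := by positivity
  have hκa : κ ≤ |a| / 2 := (min_le_left _ _).trans (min_le_left _ _)
  have hκb : κ ≤ |b| / 2 := (min_le_left _ _).trans (min_le_right _ _)
  have hκ1 : κ ≤ 1 := min_le_right _ _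
  -- from `t₀` on, the bounded order statistic takes away at most half of the dominant term
  set t₀ : ℝ := max M (max (2 * |b| * M / |a|) (2 * |a| * M / |b|)) with ht₀
  have ht0 : 0 < t₀ := lt_of_lt_of_le hM0 (le_max_left _ _)
  set γ := μ.real (Set.Ioc (-M) M) ^ (size s k - k) with hγ
  have hγ0 : 0 < γ := pow_pos hM _
  set E := ∫ ω, |T ω| ∂P with hE
  -- Markov's inequality on the event that `k` observations lie in `A`, the others in `(-M, M]`
  have hmarkov : ∀ (A : Set ℝ), MeasurableSet A → ∀ t, 0 < t →
      (∀ ω, (∀ j < size s k, (j < k → X j ω ∈ A) ∧ (k ≤ j → X j ω ∈ Set.Ioc (-M) M)) →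
        κ * t ≤ |T ω|) → t * μ.real A ^ k ≤ E / (κ * γ) := by
    intro A hA t ht h
    have h1 := mul_meas_ge_le_integral_of_nonneg (μ := P) (f := fun ω ↦ |T ω|)
      (.of_forall fun _ ↦ abs_nonneg _) hint.abs (κ * t)
    have h2 : μ.real A ^ k * γ ≤ P.real {ω | κ * t ≤ |T ω|} := by
      rw [hγ, ← measureReal_forall_mem hlaw hindep hA measurableSet_Ioc hkn]
      exact measureReal_mono h
    rw [le_div_iff₀ (by positivity)]
    calc t * μ.real A ^ k * (κ * γ) = κ * t * (μ.real A ^ k * γ) := by ring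
      _ ≤ κ * t * P.real {ω | κ * t ≤ |T ω|} := by gcongr
      _ ≤ E := h1
  have hsingle : s = 1 → ∀ ω, T ω = orderStat (sample X (size s k) ω) k := by
    intro h ω
    simp only [hT]
    subst h
    rw [one_mul, ← add_mul, hab, one_mul]
  have hupper : ∀ t, t₀ ≤ t → t * μ.real (Set.Ioi t) ^ k ≤ E / (κ * γ) := by
    intro t ht
    have htpos : 0 < t := ht0.trans_le ht
    refine hmarkov _ measurableSet_Ioi t htpos fun ω hω ↦ ?_
    obtain ⟨h1, h2⟩ := orderStat_of_large hs hk ((le_max_left _ _).trans ht) hM0.le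
      (x := sample X (size s k) ω) fun j ↦ hω j j.2
    have h3 : t ≤ |orderStat (sample X (size s k) ω) (s * k)| := h1.le.trans (le_abs_self _)
    rcases hs.eq_or_lt with hs1 | hs2
    · have h4 : s * k = k := by rw [← hs1, one_mul]
      rw [h4] at h3
      rw [hsingle hs1.symm]
      nlinarith
    · have h4 : 2 * |a| * M ≤ |b| * t := by
        rw [← div_le_iff₀' hb0]
        exact (le_max_right _ _).trans ((le_max_right _ _).trans ht)
      have h5 := mul_le_abs_lin h3 (h2 hs2) h4
      rw [add_comm] at h5
      exact le_trans (by gcongr) h5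
  have hlower : ∀ t, t₀ ≤ t → t * μ.real (Set.Iio (-t)) ^ k ≤ E / (κ * γ) := by
    intro t ht
    have htpos : 0 < t := ht0.trans_le ht
    refine hmarkov _ measurableSet_Iio t htpos fun ω hω ↦ ?_
    obtain ⟨h1, h2⟩ := orderStat_of_small hs hk ((le_max_left _ _).trans ht) hM0.le
      (x := sample X (size s k) ω) fun j ↦ hω j j.2
    have h3 : t ≤ |orderStat (sample X (size s k) ω) k| := (le_neg_of_le_neg h1).trans
      (neg_le_abs _)
    rcases hs.eq_or_lt with hs1 | hs2
    · rw [hsingle hs1.symm]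
      nlinarith
    · have h4 : 2 * |b| * M ≤ |a| * t := by
        rw [← div_le_iff₀' ha0]
        exact (le_max_left _ _).trans ((le_max_right _ _).trans ht)
      exact le_trans (by gcongr) (mul_le_abs_lin h3 (h2 hs2) h4)
  refine ⟨max t₀ (2 ^ (k - 1) * (2 * (E / (κ * γ)))), lt_max_of_lt_left ht0, fun t ht ↦ ?_⟩
  rcases le_total t₀ t with htt | htt
  · refine le_max_of_le_right ?_
    have hsplit : μ.real {x | t < |x|} ≤ μ.real (Set.Ioi t) + μ.real (Set.Iio (-t)) := by
      refine (measureReal_mono fun x hx ↦ ?_).trans (measureReal_union_le _ _)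
      rcases lt_abs.1 (show t < |x| from hx) with h | h
      · exact Or.inl h
      · exact Or.inr (lt_neg_of_lt_neg h)
    calc t * μ.real {x | t < |x|} ^ k
        ≤ t * (μ.real (Set.Ioi t) + μ.real (Set.Iio (-t))) ^ k := by gcongr
      _ ≤ t * (2 ^ (k - 1) * (μ.real (Set.Ioi t) ^ k + μ.real (Set.Iio (-t)) ^ k)) := by
          gcongr
          exact add_pow_le measureReal_nonneg measureReal_nonneg k
      _ = 2 ^ (k - 1) * (t * μ.real (Set.Ioi t) ^ k + t * μ.real (Set.Iio (-t)) ^ k) := by ring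
      _ ≤ 2 ^ (k - 1) * (2 * (E / (κ * γ))) := by
          gcongr
          linarith [hupper t htt, hlower t htt]
  · refine le_max_of_le_left (le_trans ?_ htt)
    exact mul_le_of_le_one_right ht.le (pow_le_one₀ measureReal_nonneg measureReal_le_one)

/-- A polynomial tail of the law gives a quadratic tail, uniform in `k`, for order statistics of
ranks between `k` and `sk` in a sample of size `(s+1)k - 1`: for large `t` the union bound is
`(2^{s+1} P(|X| > t))^k`. -/
lemma exists_uniform_tail_bound (hlaw : ∀ i, HasLaw (X i) μ P) (hindep : iIndepFun X P)
    {s l : ℕ} {C : ℝ} (hl : 1 ≤ l) (hC : 0 < C)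
    (htail : ∀ t, 0 < t → t * μ.real {x | t < |x|} ^ l ≤ C) :
    ∃ T : ℝ, 0 < T ∧ ∀ k, 2 * l ≤ k → ∀ i, k ≤ i → i ≤ s * k → ∀ t, T ≤ t →
      P {ω | t < |orderStat (sample X (size s k) ω) i|} ≤ ENNReal.ofReal ((T / t) ^ 2) := by
  refine ⟨2 ^ ((s + 1) * l) * C, by positivity, fun k hk i hki hik t ht ↦ ?_⟩
  set T := 2 ^ ((s + 1) * l) * C with hT
  have hT0 : 0 < T := by positivity
  have ht0 : 0 < t := hT0.trans_le ht
  have hk1 : 1 ≤ k := by omega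
  have hsz := add_size (s := s) hk1
  set h := 2 ^ (s + 1) * μ.real {x | t < |x|} with hh
  have hh0 : 0 ≤ h := by positivity
  have hhl : h ^ l ≤ T / t := by
    rw [hh, mul_pow, ← pow_mul, hT, le_div_iff₀ ht0, mul_assoc]
    gcongr
    rw [mul_comm]
    exact htail t ht0
  have hh1 : h ≤ 1 := by
    rw [← pow_le_one_iff_of_nonneg hh0 (by omega : l ≠ 0)]
    exact hhl.trans ((div_le_one ht0).2 ht)
  have hbound : h ^ k ≤ (T / t) ^ 2 := calc
    h ^ k ≤ h ^ (2 * l) := pow_le_pow_of_le_one hh0 hh1 hk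
    _ = (h ^ l) ^ 2 := by rw [mul_comm, pow_mul]
    _ ≤ (T / t) ^ 2 := by gcongr
  refine (measure_lt_abs_orderStat_le hlaw hindep (m := k) (by omega) (by omega) hki
    (by omega) t).trans ?_
  rw [ENNReal.le_ofReal_iff_toReal_le (by finiteness) (by positivity)]
  refine le_trans ?_ hbound
  rw [ENNReal.toReal_mul, ENNReal.toReal_pow, ENNReal.toReal_pow, ENNReal.toReal_ofNat, hh,
    mul_pow, ← pow_mul]
  have : size s k ≤ (s + 1) * k := Nat.sub_le _ _
  gcongr ?_ * ?_
  · exact pow_le_pow_right₀ one_le_two this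
  · exact le_rfl

end

/-! ### Fences as linear combinations of order statistics -/

lemma empQuantile_size {s k : ℕ} (m : ℕ) (x : Fin (size s k) → ℝ) :
    empQuantile x (m / (s + 1)) = orderStat x (m * k) := by
  rcases Nat.eq_zero_or_pos k with rfl | hk
  · have h0 : ∀ i, orderStat x i = 0 := fun i ↦ dif_neg (by simp only [size, mul_zero]; omega)
    rw [empQuantile, h0, h0]
  · have hsz : ((size s k : ℕ) : ℝ) + 1 = (s + 1) * k := by
      have := add_size (s := s) hk
      have h : ((size s k + 1 : ℕ) : ℝ) = ((s * k + k : ℕ) : ℝ) := by rw [this]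
      push_cast at h
      linarith
    have h : ((size s k : ℕ) + 1 : ℝ) * (m / (s + 1)) = ((m * k : ℕ) : ℝ) := by
      rw [hsz]
      push_cast
      field_simp
    rw [empQuantile, h, Nat.floor_natCast]

lemma one_sub_one_div (s : ℕ) : 1 - 1 / ((s : ℝ) + 1) = s / (s + 1) := by
  field_simp
  ring

lemma odds_one_div (s : ℕ) : (1 - 1 / ((s : ℝ) + 1)) / (1 / (s + 1)) = s := by
  field_simp
  ring

lemma empLeftFence_size {s k : ℕ} (x : Fin (size s k) → ℝ) :
    empLeftFence x (1 / (s + 1)) = (s + 1) * orderStat x k + -s * orderStat x (s * k) := by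
  have h1 := empQuantile_size 1 x
  rw [Nat.cast_one, one_mul] at h1
  rw [empLeftFence, odds_one_div, one_sub_one_div, empQuantile_size, h1]
  ring

lemma empRightFence_size {s k : ℕ} (x : Fin (size s k) → ℝ) :
    empRightFence x (1 / (s + 1)) = -s * orderStat x k + (s + 1) * orderStat x (s * k) := by
  have h1 := empQuantile_size 1 x
  rw [Nat.cast_one, one_mul] at h1
  rw [empRightFence, odds_one_div, one_sub_one_div, empQuantile_size, h1]
  ring

lemma leftFence_one_div (μ : Measure ℝ) (s : ℕ) :
    leftFence μ (1 / (s + 1)) =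
      (s + 1) * quantile μ (1 / (s + 1)) + -s * quantile μ (s / (s + 1)) := by
  rw [leftFence, odds_one_div, one_sub_one_div]
  ring

lemma rightFence_one_div (μ : Measure ℝ) (s : ℕ) :
    rightFence μ (1 / (s + 1)) =
      -s * quantile μ (1 / (s + 1)) + (s + 1) * quantile μ (s / (s + 1)) := by
  rw [rightFence, odds_one_div, one_sub_one_div]
  ring

lemma tendsto_size (s : ℕ) : Tendsto (size s) atTop atTop :=
  (tendsto_sub_atTop_nat 1).comp (tendsto_id.const_mul_atTop' (Nat.succ_pos s))

/-- For sample size `(s+1)k - 1`, the rank `mk` differs from `n m / (s+1)` by a constant. -/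
lemma tendsto_centred_rank (s m : ℕ) :
    Tendsto (fun k ↦ (√(size s k : ℝ))⁻¹ * (((m * k : ℕ) : ℝ) - size s k * (m / (s + 1))))
      atTop (𝓝 0) := by
  have hs : Tendsto (fun k ↦ (√(size s k : ℝ))⁻¹) atTop (𝓝 0) := tendsto_inv_atTop_zero.comp
    (Real.tendsto_sqrt_atTop.comp (tendsto_natCast_atTop_atTop.comp (tendsto_size s)))
  have h := hs.mul_const ((m : ℝ) / (s + 1))
  rw [zero_mul] at h
  refine h.congr' ?_
  filter_upwards [eventually_ge_atTop 1] with k hk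
  have h2 : ((size s k + 1 : ℕ) : ℝ) = ((s * k + k : ℕ) : ℝ) := by rw [add_size hk]
  push_cast at h2
  rw [show (size s k : ℝ) = s * k + k - 1 by linarith]
  push_cast
  field_simp
  ring

section

variable {Ω : Type*} [MeasurableSpace Ω] {P : Measure Ω} [IsProbabilityMeasure P]
  {μ : Measure ℝ} [IsProbabilityMeasure μ] {X : ℕ → Ω → ℝ}

/-- Both conclusions for the statistic `a X_(k) + b X_(sk)` with `a + b = 1`, which covers the
two fences at once. -/
theorem tendsto_mean_and_tendstoNormal_lin (hlaw : ∀ i, HasLaw (X i) μ P) (hindep : iIndepFun X P)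
    {s : ℕ} (hs : 1 ≤ s) {c d : ℝ} (hc : 0 < c) (hd : 0 < d)
    (hFc : HasDerivAt (fun x ↦ cdf μ x) c (quantile μ (1 / (s + 1))))
    (hFd : HasDerivAt (fun x ↦ cdf μ x) d (quantile μ (s / (s + 1))))
    {a b : ℝ} (ha : a ≠ 0) (hb : b ≠ 0) (hab : a + b = 1) :
    ((∃ k, 1 ≤ k ∧ Integrable (fun ω ↦ a * orderStat (sample X (size s k) ω) k +
        b * orderStat (sample X (size s k) ω) (s * k)) P) →
      (∀ᶠ k in atTop, Integrable (fun ω ↦ a * orderStat (sample X (size s k) ω) k +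
        b * orderStat (sample X (size s k) ω) (s * k)) P) ∧
      Tendsto (fun k ↦ ∫ ω, (a * orderStat (sample X (size s k) ω) k +
        b * orderStat (sample X (size s k) ω) (s * k)) ∂P) atTop
        (𝓝 (a * quantile μ (1 / (s + 1)) + b * quantile μ (s / (s + 1))))) ∧
    TendstoNormal P (fun k ω ↦ √(size s k : ℝ) * ((a * orderStat (sample X (size s k) ω) k +
        b * orderStat (sample X (size s k) ω) (s * k)) -
          (a * quantile μ (1 / (s + 1)) + b * quantile μ (s / (s + 1)))))
      (s / (s + 1) ^ 2 * (a ^ 2 / c ^ 2 + 2 * a * b / (s * (c * d)) + b ^ 2 / d ^ 2)) := by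
  have hs0 : (0 : ℝ) < s := by exact_mod_cast hs
  have hs1 : (1 : ℝ) ≤ s := by exact_mod_cast hs
  have hX := fun i ↦ (hlaw i).aemeasurable
  set q := quantile μ (1 / (s + 1)) with hq
  set r := quantile μ (s / (s + 1)) with hr
  have hFq : cdf μ q = 1 / (s + 1) := cdf_quantile μ (by positivity)
    ((div_lt_one (by positivity)).2 (by linarith)) hFc.continuousAt
  have hFr : cdf μ r = s / (s + 1) := cdf_quantile μ (by positivity)
    ((div_lt_one (by positivity)).2 (by linarith)) hFd.continuousAt
  have hqr : q ≤ r := by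
    rcases hs1.eq_or_lt with h | h
    · rw [hq, hr, ← h]
    · refine le_of_not_gt fun hlt ↦ ?_
      have := monotone_cdf μ hlt.le
      rw [hFq, hFr, div_le_div_iff_of_pos_right (by positivity)] at this
      linarith
  have hik : ∀ᶠ k in atTop, 1 ≤ k ∧ k ≤ size s k := by
    filter_upwards [eventually_ge_atTop 1] with k hk
    have := add_size (s := s) hk
    have : k ≤ s * k := Nat.le_mul_of_pos_left k hs
    omega
  have hjk : ∀ᶠ k in atTop, 1 ≤ s * k ∧ s * k ≤ size s k := by
    filter_upwards [eventually_ge_atTop 1] with k hk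
    have := add_size (s := s) hk
    have : k ≤ s * k := Nat.le_mul_of_pos_left k hs
    omega
  have hir : Tendsto (fun k : ℕ ↦ (√(size s k : ℝ))⁻¹ * ((k : ℝ) - size s k * cdf μ q)) atTop
      (𝓝 0) := by
    simpa [hFq] using tendsto_centred_rank s 1
  have hjr : Tendsto (fun k : ℕ ↦ (√(size s k : ℝ))⁻¹ *
      (((s * k : ℕ) : ℝ) - size s k * cdf μ r)) atTop (𝓝 0) := by
    rw [hFr]
    exact tendsto_centred_rank s s
  refine ⟨?_, ?_⟩
  · rintro ⟨l, hl, hint⟩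
    obtain ⟨C, hC, htail⟩ := exists_tail_bound_of_integrable hlaw hindep hs hl ha hb hab hint
    obtain ⟨T, hT, hbound⟩ := exists_uniform_tail_bound (s := s) hlaw hindep hl hC htail
    have h1 := integrable_and_tendsto_integral_of_lintegral_abs_sub (q := q)
      (fun k ↦ aemeasurable_orderStat_sample hX (size s k) k)
      (tendsto_lintegral_abs_sub_of_tail_le (fun k ↦ aemeasurable_orderStat_sample hX _ _) hT
        (fun t ht ↦ tendsto_measure_lt_abs_orderStat_sub hlaw hindep hc hFc (tendsto_size s) hik
          hir ht) (by
        filter_upwards [eventually_ge_atTop (2 * l)] with k hk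
        exact hbound k hk k le_rfl (Nat.le_mul_of_pos_left k hs)))
    have h2 := integrable_and_tendsto_integral_of_lintegral_abs_sub (q := r)
      (fun k ↦ aemeasurable_orderStat_sample hX (size s k) (s * k))
      (tendsto_lintegral_abs_sub_of_tail_le (fun k ↦ aemeasurable_orderStat_sample hX _ _) hT
        (fun t ht ↦ tendsto_measure_lt_abs_orderStat_sub hlaw hindep hd hFd (tendsto_size s) hjk
          hjr ht) (by
        filter_upwards [eventually_ge_atTop (2 * l)] with k hk
        exact hbound k hk (s * k) (Nat.le_mul_of_pos_left k hs) le_rfl))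
    constructor
    · filter_upwards [h1.1, h2.1] with k hk1 hk2
      exact (hk1.const_mul a).add (hk2.const_mul b)
    · refine ((h1.2.const_mul a).add (h2.2.const_mul b)).congr' ?_
      filter_upwards [h1.1, h2.1] with k hk1 hk2
      rw [integral_add (hk1.const_mul a) (hk2.const_mul b), integral_const_mul,
        integral_const_mul]
  · have h := tendstoNormal_orderStat_lin hlaw hindep hqr hc hd hFc hFd (tendsto_size s) hik hjk
      hir hjr a b
    rw [hFq, hFr] at h
    convert h using 1
    field_simp
    ring

end

end Fences

theorem mainTheorem1 {Ω : Type*} [MeasurableSpace Ω] (P : Measure Ω) [IsProbabilityMeasure P]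
    (μ : Measure ℝ) [IsProbabilityMeasure μ] (hac : μ ≪ volume)
    (X : ℕ → Ω → ℝ) (hlaw : ∀ i, HasLaw (X i) μ P) (hindep : iIndepFun X P)
    (s : ℕ) (hs : 1 ≤ s) (c d : ℝ) (hc : 0 < c) (hd : 0 < d)
    (hFc : HasDerivAt (fun x ↦ cdf μ x) c (Fences.quantile μ (1 / (s + 1))))
    (hFd : HasDerivAt (fun x ↦ cdf μ x) d (Fences.quantile μ (s / (s + 1)))) :
    let L : ℕ → Ω → ℝ := fun k ω ↦
      Fences.empLeftFence (Fences.sample X (Fences.size s k) ω) (1 / (s + 1))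
    let R : ℕ → Ω → ℝ := fun k ω ↦
      Fences.empRightFence (Fences.sample X (Fences.size s k) ω) (1 / (s + 1))
    ((∃ k, 1 ≤ k ∧ Integrable (L k) P) →
      (∀ᶠ k in atTop, Integrable (L k) P) ∧
        Tendsto (fun k ↦ ∫ ω, L k ω ∂P) atTop (𝓝 (Fences.leftFence μ (1 / (s + 1))))) ∧
    ((∃ k, 1 ≤ k ∧ Integrable (R k) P) →
      (∀ᶠ k in atTop, Integrable (R k) P) ∧
        Tendsto (fun k ↦ ∫ ω, R k ω ∂P) atTop (𝓝 (Fences.rightFence μ (1 / (s + 1))))) ∧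
    Fences.TendstoNormal P
      (fun k ω ↦ √(Fences.size s k : ℝ) * (L k ω - Fences.leftFence μ (1 / (s + 1))))
      (Fences.varLeft s c d) ∧
    Fences.TendstoNormal P
      (fun k ω ↦ √(Fences.size s k : ℝ) * (R k ω - Fences.rightFence μ (1 / (s + 1))))
      (Fences.varRight s c d) := by
  intro L R
  have hs0 : (s : ℝ) ≠ 0 := by exact_mod_cast (by omega : s ≠ 0)
  have hs1 : (s : ℝ) + 1 ≠ 0 := by positivity
  obtain ⟨hL1, hL2⟩ := Fences.tendsto_mean_and_tendstoNormal_lin hlaw hindep hs hc hd hFc hFd hs1 (neg_ne_zero.2 hs0)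
    (by ring)
  obtain ⟨hR1, hR2⟩ := Fences.tendsto_mean_and_tendstoNormal_lin hlaw hindep hs hc hd hFc hFd (neg_ne_zero.2 hs0) hs1
    (by ring)
  simp only [L, R, Fences.empLeftFence_size, Fences.empRightFence_size, Fences.leftFence_one_div,
    Fences.rightFence_one_div]
  refine ⟨hL1, hR1, ?_, ?_⟩
  · convert hL2 using 1
    rw [Fences.varLeft]
    field_simp
    ring
  · convert hR2 using 1
    rw [Fences.varRight]
    field_simp
    ring
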